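/- **Setting.** Compacta are compact Hausdorff spaces, and $\mathrm{Comp}$ is the category of compacta and continuous maps. A *continuous t-norm* is a continuous, associative, commutative, monotone operation $\ast:[0,1]^2\to[0,1]$ with $s\ast 1=s$ for all $s$. Let $X$ be a compactum. *Possibility capacities.* A *capacity* on $X$ is a function $\nu$ from the closed subsets of $X$ to $[0,1]$ with $\nu(\emptyset)=0$, $\nu(X)=1$, $\nu(F)\le\nu(G)$ for $F\subset G$, and such that $\nu(F)<a$ (with $a\in[0,1]$) implies that there is an open $O\supset F$ with $\nu(B)<a$ for every closed $B\subset O$. For open $U$ put $\nu(U)=\sup\{\nu(K)\mid K\subset U \text{ closed}\}$. The set of capacities has the topology with subbase $\{\nu\mid\nu(F)<a\}$, $\{\nu\mid\nu(U)>a\}$ ($F$ closed, $U$ open, $a\in[0,1]$). A capacity is a *possibility capacity* if $\nu(\bigcup_t A_t)=\sup_t\nu(A_t)$ for every family of closed sets whose union is closed; $\Pi X$ is the subspace of possibility capacities. It is a compactum, and $\Pi f(\nu)(A)=\nu(f^{-1}(A))$ makes $\Pi$ an endofunctor of $\mathrm{Comp}$. The monad $\mathbb U_\ast=(\Pi,\eta,\mu_\ast)$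 has $\eta X(x)(F)=1$ if $x\in F$ and $0$ otherwise, and $$\mu_\ast X(\mathcal C)(F)=\max\{\mathcal C(\{\nu\in\Pi X\mid \nu(F)\ge t\})\ast t\mid t\in(0,1]\}.$$ *$\ast$-measures.* $A^\ast X\subset[0,1]^{C(X,[0,1])}$ (product topology) is the space of all $m:C(X,[0,1])\to[0,1]$ with $m(1_X)=1$, $m(\varphi\vee\psi)=m(\varphi)\vee m(\psi)$ and $m(c_X\ast\varphi)=c\ast m(\varphi)$ for all $\varphi,\psi\in C(X,[0,1])$ and $c\in[0,1]$, where $c_X$ is the constant function with value $c$. It is a compactum. Let $\pi_\varphi:A^\ast X\to[0,1]$, $\pi_\varphi(m)=m(\varphi)$. The monad $\mathbb A^\ast=(A^\ast,h,m)$ is given by $\pi_\varphi\circ A^\ast f=\pi_{\varphi\circ f}$, $\pi_\varphi\circ hX=\varphi$ and $\pi_\varphi\circ mX=\pi_{\pi_\varphi}$. **Theorem.** Let $\ast$ be a continuous t-norm. For a compactum $X$, $\nu\in\Pi X$ and $\varphi\in C(X,[0,1])$ put $$lX(\nu)(\varphi)=\int_X^{\vee\ast}\varphi\,d\nu=\max\{\nu(\varphi^{-1}([t,1]))\ast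 t\mid t\in[0,1]\}.$$ Then the maps $lX$ are the components of a natural transformation $l:\Pi\to A^\ast$, and $l$ is an isomorphism of monads $\mathbb U_\ast\to\mathbb A^\ast$. That is, each $lX$ is a well-defined homeomorphism $\Pi X\to A^\ast X$, the maps $lX$ are natural in $X$, and for every compactum $X$ $$lX\circ\eta X=hX,\qquad lX\circ\mu_\ast X=mX\circ lA^\ast X\circ\Pi(lX).$$ -/

import Mathlib

open CategoryTheory TopologicalSpace

universe u

namespace PossibilityMonad

/-- The closed unit interval `[0,1]`. -/
abbrev I : Type := unitInterval

/-- A continuous triangular norm on `[0,1]`: an associative, commutative, monotone operation with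
unit `1` that is jointly continuous. -/
structure ContinuousTNorm where
  op : I → I → I
  op_assoc : ∀ r s t, op (op r s) t = op r (op s t)
  op_comm : ∀ s t, op s t = op t s
  op_mono : ∀ r s t, r ≤ s → op r t ≤ op s t
  op_one : ∀ s, op s 1 = s
  op_continuous : Continuous fun p : I × I => op p.1 p.2

namespace ContinuousTNorm

variable (T : ContinuousTNorm)

theorem op_le_op {r r' s s' : I} (h : r ≤ r') (h' : s ≤ s') : T.op r s ≤ T.op r' s' :=
  (T.op_mono _ _ _ h).trans (by rw [T.op_comm r', T.op_comm r']; exact T.op_mono _ _ _ h')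

theorem one_op (s : I) : T.op 1 s = s := by rw [T.op_comm, T.op_one]

theorem op_le_left (r s : I) : T.op r s ≤ r :=
  (T.op_le_op le_rfl (show s ≤ 1 from le_top)).trans (T.op_one r).le

theorem op_le_right (r s : I) : T.op r s ≤ s := by rw [T.op_comm]; exact T.op_le_left s r

theorem zero_op (s : I) : T.op 0 s = 0 := le_antisymm (T.op_le_left 0 s) bot_le

theorem op_zero (s : I) : T.op s 0 = 0 := by rw [T.op_comm, T.zero_op]

theorem op_sup (r s t : I) : T.op r (s ⊔ t) = T.op r s ⊔ T.op r t := by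
  have : Monotone (T.op r) := fun _ _ h => T.op_le_op le_rfl h
  exact this.map_sup s t

theorem sup_op (r s t : I) : T.op (r ⊔ s) t = T.op r t ⊔ T.op s t := by
  rw [T.op_comm, T.op_sup, T.op_comm t, T.op_comm t]

theorem op_iSup {ι : Sort*} (r : I) (g : ι → I) : T.op r (⨆ i, g i) = ⨆ i, T.op r (g i) := by
  have hm : Monotone (T.op r) := fun _ _ h => T.op_le_op le_rfl h
  have hc : Continuous (T.op r) := T.op_continuous.comp (by fun_prop : Continuous fun s : I => (r, s))
  exact hm.map_iSup_of_continuousAt hc.continuousAt (T.op_zero r)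

theorem iSup_op {ι : Sort*} (r : I) (g : ι → I) : T.op (⨆ i, g i) r = ⨆ i, T.op (g i) r := by
  rw [T.op_comm, T.op_iSup]; simp only [T.op_comm r]

theorem exists_gt {r s a : I} (h : T.op r s < a) :
    ∃ r' s', T.op r' s' < a ∧ (r < r' ∨ r' = 1) ∧ (s < s' ∨ s' = 1) := by
  have aux : ∀ x : I, ∀ P : I → Prop, (∀ᶠ y in nhds x, P y) → ∃ y, P y ∧ (x < y ∨ y = 1) := by
    intro x P hP
    rcases eq_or_lt_of_le (show x ≤ 1 from le_top) with h1 | h1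
    · exact ⟨x, hP.self_of_nhds, Or.inr h1⟩
    · obtain ⟨b, hb, hsub⟩ := exists_Ico_subset_of_mem_nhds hP ⟨1, h1⟩
      obtain ⟨y, hy1, hy2⟩ := exists_between hb
      exact ⟨y, hsub ⟨hy1.le, hy2⟩, Or.inl hy1⟩
  have hev := (T.op_continuous.tendsto (r, s)).eventually (gt_mem_nhds h)
  rw [nhds_prod_eq] at hev
  obtain ⟨P, hP, Q, hQ, hPQ⟩ := Filter.eventually_prod_iff.1 hev
  obtain ⟨r', hr, hr'⟩ := aux r P hP
  obtain ⟨s', hs, hs'⟩ := aux s Q hQ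
  exact ⟨r', s', hPQ hr hs, hr', hs'⟩

theorem exists_lt {r s a : I} (h : a < T.op r s) :
    ∃ r' s', a < T.op r' s' ∧ r' < r ∧ s' < s := by
  have aux : ∀ x : I, 0 < x → ∀ P : I → Prop, (∀ᶠ y in nhds x, P y) → ∃ y, P y ∧ y < x := by
    intro x h1 P hP
    obtain ⟨b, hb, hsub⟩ := exists_Ioc_subset_of_mem_nhds hP ⟨0, h1⟩
    obtain ⟨y, hy1, hy2⟩ := exists_between hb
    exact ⟨y, hsub ⟨hy1, hy2.le⟩, hy2⟩
  have h0 : 0 < T.op r s := lt_of_le_of_lt bot_le h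
  have hev := (T.op_continuous.tendsto (r, s)).eventually (lt_mem_nhds h)
  rw [nhds_prod_eq] at hev
  obtain ⟨P, hP, Q, hQ, hPQ⟩ := Filter.eventually_prod_iff.1 hev
  obtain ⟨r', hr, hr'⟩ := aux r (h0.trans_le (T.op_le_left r s)) P hP
  obtain ⟨s', hs, hs'⟩ := aux s (h0.trans_le (T.op_le_right r s)) Q hQ
  exact ⟨r', s', hPQ hr hs, hr', hs'⟩

end ContinuousTNorm

/-! ### Capacities -/

/-- An upper-semicontinuous (normed) capacity on `X`, as a function on the closed subsets. -/
@[ext]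
structure Capacity (X : Type u) [TopologicalSpace X] where
  toFun : Closeds X → I
  map_univ : toFun ⊤ = 1
  map_empty : toFun ⊥ = 0
  mono : ∀ F G : Closeds X, F ≤ G → toFun F ≤ toFun G
  usc : ∀ (F : Closeds X) (a : I), toFun F < a →
    ∃ O : Opens X, (F : Set X) ⊆ O ∧ ∀ B : Closeds X, (B : Set X) ⊆ O → toFun B < a

instance (X : Type u) [TopologicalSpace X] : CoeFun (Capacity X) fun _ => Closeds X → I :=
  ⟨Capacity.toFun⟩

namespace Capacity

variable {X : Type u} [TopologicalSpace X]

/-- The extension of a capacity to open sets. -/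
noncomputable def onOpen (ν : Capacity X) (U : Opens X) : I :=
  sSup {r | ∃ K : Closeds X, (K : Set X) ⊆ U ∧ ν K = r}

/-- The topology on the space of capacities, with the subbase of all sets
`{c | c F < a}`, `F` closed, and `{c | c U > a}`, `U` open, `a ∈ [0,1]`. -/
instance : TopologicalSpace (Capacity X) :=
  generateFrom
    ({S | ∃ (F : Closeds X) (a : I), S = {c : Capacity X | c F < a}} ∪
      {S | ∃ (U : Opens X) (a : I), S = {c : Capacity X | a < c.onOpen U}})

/-- Possibility capacities: the value on a closed union of an arbitrary family of closed sets is
the supremum (in `[0,1]`) of the values on the members. -/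
def IsPossibility (ν : Capacity X) : Prop :=
  ∀ (ι : Type u) (A : ι → Closeds X) (B : Closeds X), (B : Set X) = ⋃ i, (A i : Set X) →
    ν B = ⨆ i, ν (A i)

theorem lt_onOpen {ν : Capacity X} {U : Opens X} {a : I} :
    a < ν.onOpen U ↔ ∃ K : Closeds X, (K : Set X) ⊆ U ∧ a < ν K := by
  simp only [onOpen, lt_sSup_iff, Set.mem_ofPred_eq]
  constructor
  · rintro ⟨_, ⟨K, hK, rfl⟩, h⟩; exact ⟨K, hK, h⟩
  · rintro ⟨K, hK, h⟩; exact ⟨_, ⟨K, hK, rfl⟩, h⟩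

theorem isOpen_lt (F : Closeds X) (a : I) : IsOpen {c : Capacity X | c F < a} :=
  isOpen_generateFrom_of_mem (Or.inl ⟨F, a, rfl⟩)

theorem isOpen_gt (U : Opens X) (a : I) : IsOpen {c : Capacity X | a < c.onOpen U} :=
  isOpen_generateFrom_of_mem (Or.inr ⟨U, a, rfl⟩)

end Capacity

/-- The space `ΠX` of possibility capacities, with the subspace topology. -/
def Poss (X : Type u) [TopologicalSpace X] : Type u := {ν : Capacity X // ν.IsPossibility}

instance (X : Type u) [TopologicalSpace X] : TopologicalSpace (Poss X) :=
  inferInstanceAs (TopologicalSpace {ν : Capacity X // ν.IsPossibility})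

instance (X : Type u) [TopologicalSpace X] : CoeFun (Poss X) fun _ => Closeds X → I :=
  ⟨fun ν => ν.1.toFun⟩

/-- The closed superlevel set `{x | t ≤ g x}` of an upper-semicontinuous function. -/
def superlevel {X : Type u} [TopologicalSpace X] (g : X → I) (hg : UpperSemicontinuous g) (t : I) :
    Closeds X :=
  ⟨{x | t ≤ g x}, upperSemicontinuous_iff_isClosed_preimage.1 hg t⟩

namespace Poss

section basic

variable {X : Type u} [TopologicalSpace X]

theorem ext {ν ν' : Poss X} (h : ∀ F, ν F = ν' F) : ν = ν' :=
  Subtype.ext (Capacity.ext (funext h))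

theorem isOpen_lt (F : Closeds X) (a : I) : IsOpen {c : Poss X | c F < a} :=
  (Capacity.isOpen_lt F a).preimage continuous_subtype_val

theorem isOpen_gt (U : Opens X) (a : I) : IsOpen {c : Poss X | a < c.1.onOpen U} :=
  (Capacity.isOpen_gt U a).preimage continuous_subtype_val

theorem continuous_of {Y : Type*} [TopologicalSpace Y] (g : Y → Poss X)
    (h1 : ∀ F a, IsOpen {y | g y F < a}) (h2 : ∀ U a, IsOpen {y | a < (g y).1.onOpen U}) :
    Continuous g := by
  refine Continuous.subtype_mk (p := Capacity.IsPossibility) (f := fun y => (g y).1) ?_ _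
  refine continuous_generateFrom_iff.2 ?_
  rintro S (⟨F, a, rfl⟩ | ⟨U, a, rfl⟩)
  exacts [h1 F a, h2 U a]

/-- Evaluation at a closed set is upper-semicontinuous on `ΠX`. -/
theorem usc_eval (F : Closeds X) : UpperSemicontinuous fun ν : Poss X => ν F :=
  upperSemicontinuous_iff_isOpen_preimage.2 fun a => isOpen_lt F a

theorem mono (ν : Poss X) {F G : Closeds X} (h : F ≤ G) : ν F ≤ ν G := ν.1.mono F G h

theorem map_sup (ν : Poss X) (F G : Closeds X) : ν (F ⊔ G) = ν F ⊔ ν G := by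
  have := ν.2 (ULift Bool) (fun b => cond b.down F G) (F ⊔ G) (by
    ext x; simp [Equiv.ulift.exists_congr_left, or_comm])
  rw [this]
  apply le_antisymm
  · refine iSup_le ?_
    rintro ⟨_ | _⟩
    exacts [le_sup_right, le_sup_left]
  · exact sup_le (le_iSup_of_le ⟨true⟩ le_rfl) (le_iSup_of_le ⟨false⟩ le_rfl)

end basic

section T1

variable {X : Type u} [TopologicalSpace X] [T1Space X]

/-- The closed one-point set `{x}`. -/
def pt (x : X) : Closeds X := ⟨{x}, isClosed_singleton⟩

theorem pt_le {x : X} {F : Closeds X} : pt x ≤ F ↔ x ∈ F :=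
  Set.singleton_subset_iff (a := x) (s := (F : Set X))

theorem eq_iSup (ν : Poss X) (F : Closeds X) : ν F = ⨆ x : F, ν (pt x.1) :=
  ν.2 F (fun x => pt x.1) F (by ext x; simp [pt])

theorem exists_pt {ν : Poss X} {F : Closeds X} {a : I} (h : a < ν F) :
    ∃ x ∈ F, a < ν (pt x) := by
  rw [eq_iSup, lt_iSup_iff] at h
  obtain ⟨x, hx⟩ := h
  exact ⟨x.1, x.2, hx⟩

/-- Layer-cake and pointwise form of the integral of an upper-semicontinuous function. -/
theorem iSup_superlevel (T : ContinuousTNorm) (ν : Poss X) (g : X → I)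
    (hg : UpperSemicontinuous g) :
    (⨆ t : I, T.op (ν (superlevel g hg t)) t) = ⨆ x, T.op (ν (pt x)) (g x) := by
  apply le_antisymm
  · refine iSup_le fun t => ?_
    rw [eq_iSup, T.iSup_op]
    exact iSup_le fun x => le_iSup_of_le x.1 (T.op_le_op le_rfl x.2)
  · refine iSup_le fun x => le_iSup_of_le (g x) (T.op_le_op (ν.mono (pt_le.2 ?_)) le_rfl)
    exact le_refl (g x)

end T1

theorem iSup_pos (T : ContinuousTNorm) (f : I → I) :
    (⨆ t : Set.Ioc (0 : I) 1, T.op (f t) t) = ⨆ t : I, T.op (f t) t := by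
  apply le_antisymm
  · exact iSup_le fun t => le_iSup (fun t : I => T.op (f t) t) t.1
  · refine iSup_le fun t => ?_
    rcases eq_or_lt_of_le (show 0 ≤ t from bot_le) with h | h
    · rw [← h, T.op_zero]; exact bot_le
    · exact le_iSup (fun t : Set.Ioc (0 : I) 1 => T.op (f t) t) ⟨t, h, le_top⟩

section compact

variable {X : Type u} [TopologicalSpace X] [CompactSpace X] [T2Space X]

theorem exists_closed_between {F : Closeds X} {O : Opens X} (h : (F : Set X) ⊆ O) :
    ∃ (V : Opens X) (B : Closeds X), (F : Set X) ⊆ V ∧ (V : Set X) ⊆ B ∧ (B : Set X) ⊆ O := by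
  obtain ⟨V, hV, hFV, hVO⟩ := normal_exists_closure_subset F.isClosed O.isOpen h
  exact ⟨⟨V, hV⟩, ⟨closure V, isClosed_closure⟩, hFV, subset_closure, hVO⟩

theorem isPossibility_of_sup (ν : Capacity X) (h : ∀ F G, ν (F ⊔ G) ≤ ν F ⊔ ν G) :
    ν.IsPossibility := by
  intro ι A B hB
  have hle : ∀ i, A i ≤ B := fun i => by
    intro x hx
    have : x ∈ ⋃ i, (A i : Set X) := Set.mem_iUnion.2 ⟨i, hx⟩
    rwa [← hB] at this
  apply le_antisymm _ (iSup_le fun i => ν.mono _ _ (hle i))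
  by_contra! hlt
  obtain ⟨a, ha1, ha2⟩ := exists_between hlt
  -- every point of `B` has a closed neighbourhood of small capacity
  have hloc : ∀ x ∈ (B : Set X), ∃ V ∈ nhds x, ∀ F : Closeds X, (F : Set X) ⊆ V → ν F < a := by
    intro x hx
    rw [hB] at hx
    obtain ⟨i, hi⟩ := Set.mem_iUnion.1 hx
    obtain ⟨O, hO, hO'⟩ := ν.usc (A i) a ((le_iSup (fun i => ν (A i)) i).trans_lt ha1)
    exact ⟨O, O.isOpen.mem_nhds (hO hi), hO'⟩
  have h0a : 0 < a := lt_of_le_of_lt bot_le ha1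
  have key : ∃ C : Closeds X, (B : Set X) ⊆ C ∧ ν C < a := by
    refine B.isClosed.isCompact.induction_on
      (p := fun s => ∃ C : Closeds X, s ⊆ C ∧ ν C < a) ?_ ?_ ?_ ?_
    · exact ⟨⊥, Set.empty_subset _, by rw [ν.map_empty]; exact h0a⟩
    · rintro s t hst ⟨C, hC, hC'⟩; exact ⟨C, hst.trans hC, hC'⟩
    · rintro s t ⟨C, hC, hC'⟩ ⟨D, hD, hD'⟩
      refine ⟨C ⊔ D, ?_, (h C D).trans_lt (max_lt hC' hD')⟩
      rw [Closeds.coe_sup]; exact Set.union_subset_union hC hD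
    · intro x hx
      obtain ⟨V, hV, hV'⟩ := hloc x hx
      obtain ⟨W, hW, hWc, hWV⟩ := exists_mem_nhds_isClosed_subset hV
      exact ⟨W, mem_nhdsWithin_of_mem_nhds hW, ⟨W, hWc⟩, le_rfl, hV' _ hWV⟩
  obtain ⟨C, hC, hC'⟩ := key
  exact absurd (ν.mono B C hC) (not_le.2 (hC'.trans ha2))

instance : T2Space (Poss X) := by
  have sep : ∀ (ν ν' : Poss X) (F : Closeds X), ν F < ν' F →
      ∃ u v : Set (Poss X), IsOpen u ∧ IsOpen v ∧ ν ∈ u ∧ ν' ∈ v ∧ Disjoint u v := by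
    intro ν ν' F hF
    obtain ⟨a, ha1, ha2⟩ := exists_between hF
    obtain ⟨O, hO, hO'⟩ := ν.1.usc F a ha1
    obtain ⟨V, B, hFV, hVB, hBO⟩ := exists_closed_between hO
    refine ⟨_, _, isOpen_lt B a, isOpen_gt V a, hO' B hBO, Capacity.lt_onOpen.2 ⟨F, hFV, ha2⟩, ?_⟩
    rw [Set.disjoint_left]
    intro c hc hc'
    obtain ⟨K, hK, hK'⟩ := Capacity.lt_onOpen.1 hc'
    exact absurd (hK'.trans_le (c.mono (hK.trans hVB))) (not_lt.2 (le_of_lt hc))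
  refine ⟨fun ν ν' hne => ?_⟩
  have : ∃ F, ν F ≠ ν' F := by
    by_contra! h; exact hne (ext h)
  obtain ⟨F, hF⟩ := this
  rcases lt_or_gt_of_ne hF with h | h
  · exact sep ν ν' F h
  · obtain ⟨u, v, hu, hv, h1, h2, hd⟩ := sep ν' ν F h
    exact ⟨v, u, hv, hu, h2, h1, hd.symm⟩

instance : CompactSpace (Poss X) := by
  rw [← isCompact_univ_iff, isCompact_iff_ultrafilter_le_nhds]
  intro 𝒰 _
  have hlim : ∀ F : Closeds X, ∃ l : I, Filter.Tendsto (fun ν : Poss X => ν F) 𝒰 (nhds l) := by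
    intro F
    obtain ⟨l, -, hl⟩ := isCompact_iff_ultrafilter_le_nhds.1 (isCompact_univ (X := I))
      (𝒰.map fun ν : Poss X => ν F) (by simp)
    exact ⟨l, hl⟩
  choose L hL using hlim
  have hLmono : ∀ F G, F ≤ G → L F ≤ L G := fun F G h =>
    le_of_tendsto_of_tendsto' (hL F) (hL G) fun ν => ν.mono h
  have hLsup : ∀ F G, L (F ⊔ G) = L F ⊔ L G := fun F G =>
    tendsto_nhds_unique (hL _) (((hL F).sup_nhds (hL G)).congr fun ν => (ν.map_sup F G).symm)
  let N : Closeds X → I := fun F =>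
    sInf {r | ∃ (V : Opens X) (B : Closeds X), (F : Set X) ⊆ V ∧ (V : Set X) ⊆ B ∧ L B = r}
  have hNle : ∀ (F : Closeds X) (V : Opens X) (B : Closeds X), (F : Set X) ⊆ V →
      (V : Set X) ⊆ B → N F ≤ L B := fun F V B h1 h2 => sInf_le ⟨V, B, h1, h2, rfl⟩
  have hNlt : ∀ (F : Closeds X) (a : I), N F < a → ∃ (V : Opens X) (B : Closeds X),
      (F : Set X) ⊆ V ∧ (V : Set X) ⊆ B ∧ L B < a := by
    intro F a h
    obtain ⟨_, ⟨V, B, h1, h2, rfl⟩, h3⟩ := sInf_lt_iff.1 h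
    exact ⟨V, B, h1, h2, h3⟩
  have hLN : ∀ F, L F ≤ N F := fun F => le_sInf (by
    rintro _ ⟨V, B, h1, h2, rfl⟩; exact hLmono _ _ (h1.trans h2))
  let ν₀ : Capacity X :=
    { toFun := N
      map_univ := by
        refine le_antisymm le_top (le_trans ?_ (hLN ⊤))
        exact ge_of_tendsto' (hL ⊤) fun ν => ν.1.map_univ.ge
      map_empty := by
        refine le_antisymm ((hNle ⊥ ⊥ ⊥ (by simp) (by simp)).trans ?_) bot_le
        exact le_of_tendsto' (hL ⊥) fun ν => ν.1.map_empty.le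
      mono := fun F G h => le_sInf (by
        rintro _ ⟨V, B, h1, h2, rfl⟩; exact hNle F V B (Set.Subset.trans h h1) h2)
      usc := by
        intro F a h
        obtain ⟨V, B, h1, h2, h3⟩ := hNlt F a h
        exact ⟨V, h1, fun C hC => (hNle C V B hC h2).trans_lt h3⟩ }
  have hν₀ : ν₀.IsPossibility := by
    refine isPossibility_of_sup ν₀ fun F G => ?_
    refine le_of_forall_gt fun a ha => ?_
    obtain ⟨V, B, h1, h2, h3⟩ := hNlt F a (lt_of_le_of_lt le_sup_left ha)
    obtain ⟨V', B', h1', h2', h3'⟩ := hNlt G a (lt_of_le_of_lt le_sup_right ha)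
    refine (hNle (F ⊔ G) (V ⊔ V') (B ⊔ B') ?_ ?_).trans_lt ?_
    · rw [Closeds.coe_sup, Opens.coe_sup]; exact Set.union_subset_union h1 h1'
    · rw [Closeds.coe_sup, Opens.coe_sup]; exact Set.union_subset_union h2 h2'
    · rw [hLsup]; exact max_lt h3 h3'
  refine ⟨⟨ν₀, hν₀⟩, Set.mem_univ _, ?_⟩
  have hval : Filter.Tendsto (fun c : Poss X => c.1) 𝒰 (nhds ν₀) := by
    refine TopologicalSpace.tendsto_nhds_generateFrom_iff.2 ?_
    rintro S (⟨F, a, rfl⟩ | ⟨U, a, rfl⟩) hS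
    · obtain ⟨V, B, h1, h2, h3⟩ := hNlt F a hS
      filter_upwards [(hL B).eventually (gt_mem_nhds h3)] with c hc
      exact (c.mono (h1.trans h2)).trans_lt hc
    · obtain ⟨K, hK, hK'⟩ := Capacity.lt_onOpen.1 hS
      obtain ⟨V, B, h1, h2, h3⟩ := exists_closed_between hK
      have : a < L B := lt_of_lt_of_le hK' (hNle K V B h1 h2)
      filter_upwards [(hL B).eventually (lt_mem_nhds this)] with c hc
      exact Capacity.lt_onOpen.2 ⟨B, h3, hc⟩
  have : (𝒰 : Filter (Poss X)) ≤ nhds (⟨ν₀, hν₀⟩ : Poss X) := by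
    have h2 : nhds (⟨ν₀, hν₀⟩ : Poss X) = Filter.comap Subtype.val (nhds ν₀) :=
      nhds_subtype_eq_comap
    rw [h2]; exact Filter.tendsto_iff_comap.1 hval
  exact this

/-- The main covering argument: if all pointwise values are below `a`, they stay below `a`
uniformly for capacities close to `ν`. -/
theorem exists_cover (T : ContinuousTNorm) (ν : Poss X) (g : X → I) (hg : UpperSemicontinuous g)
    (a : I) (h : ∀ x, T.op (ν (pt x)) (g x) < a) :
    ∃ b < a, ∀ᶠ c in nhds ν, ∀ x, T.op (c (pt x)) (g x) ≤ b := by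
  have h0a : 0 < a := by
    have : (0 : I) < ν ⊤ := by rw [ν.1.map_univ]; exact zero_lt_one
    obtain ⟨x, -, -⟩ := exists_pt this
    exact lt_of_le_of_lt bot_le (h x)
  have := isCompact_univ (X := X).induction_on
    (p := fun s => ∃ b < a, ∀ᶠ c in nhds ν, ∀ x ∈ s, T.op (c (pt x)) (g x) ≤ b)
    ⟨0, h0a, by simp⟩
    (by
      rintro s t hst ⟨b, hb, H⟩
      exact ⟨b, hb, H.mono fun c hc x hx => hc x (hst hx)⟩)
    (by
      rintro s t ⟨b, hb, H⟩ ⟨b', hb', H'⟩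
      refine ⟨b ⊔ b', max_lt hb hb', ?_⟩
      filter_upwards [H, H'] with c hc hc' x hx
      rcases hx with hx | hx
      exacts [(hc x hx).trans le_sup_left, (hc' x hx).trans le_sup_right])
    (by
      intro x _
      obtain ⟨r, s, hrs, hr, hs⟩ := T.exists_gt (h x)
      have hgs : ∀ᶠ y in nhds x, g y ≤ s := by
        rcases hs with hs | rfl
        · exact (hg x s hs).mono fun y hy => le_of_lt hy
        · exact Filter.Eventually.of_forall fun y => le_top
      rcases hr with hr | rfl
      · obtain ⟨O, hO, hO'⟩ := ν.1.usc (pt x) r hr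
        obtain ⟨W, hW, hWc, hWO⟩ :=
          exists_mem_nhds_isClosed_subset (O.isOpen.mem_nhds (hO (Set.mem_singleton x)))
        refine ⟨W ∩ {y | g y ≤ s}, mem_nhdsWithin_of_mem_nhds (Filter.inter_mem hW hgs),
          T.op r s, hrs, ?_⟩
        filter_upwards [(isOpen_lt ⟨W, hWc⟩ r).mem_nhds (hO' ⟨W, hWc⟩ hWO)] with c hc y hy
        exact T.op_le_op ((c.mono (pt_le.2 hy.1)).trans (le_of_lt hc)) hy.2
      · refine ⟨{y | g y ≤ s}, mem_nhdsWithin_of_mem_nhds hgs, T.op 1 s, hrs, ?_⟩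
        exact Filter.Eventually.of_forall fun c y hy => T.op_le_op le_top hy)
  simpa using this

/-- The supremum in the integral of an upper-semicontinuous function is attained at a point. -/
theorem exists_eq_iSup (T : ContinuousTNorm) (ν : Poss X) (g : X → I)
    (hg : UpperSemicontinuous g) :
    ∃ x, T.op (ν (pt x)) (g x) = ⨆ y, T.op (ν (pt y)) (g y) := by
  by_contra! hne
  have hlt : ∀ x, T.op (ν (pt x)) (g x) < ⨆ y, T.op (ν (pt y)) (g y) := fun x =>
    lt_of_le_of_ne (le_iSup (fun y => T.op (ν (pt y)) (g y)) x) (hne x)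
  obtain ⟨b, hb, H⟩ := exists_cover T ν g hg _ hlt
  exact absurd (iSup_le H.self_of_nhds) (not_le.2 hb)

/-! ### The functor `Π` -/

variable {Y : Type u} [TopologicalSpace Y] [CompactSpace Y] [T2Space Y]

/-- The preimage of a closed set under a continuous map. -/
def pre (f : C(X, Y)) (A : Closeds Y) : Closeds X := ⟨f ⁻¹' A, A.isClosed.preimage f.continuous⟩

/-- The push-forward `Πf(ν)(A) = ν(f⁻¹(A))`. -/
def map (f : C(X, Y)) (ν : Poss X) : Poss Y :=
  ⟨{ toFun := fun A => ν (pre f A)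
     map_univ := ν.1.map_univ
     map_empty := ν.1.map_empty
     mono := fun F G h => ν.mono fun x hx => h hx
     usc := by
       intro F a h
       obtain ⟨O, hO, hO'⟩ := ν.1.usc _ a h
       refine ⟨⟨(f '' (O : Set X)ᶜ)ᶜ,
         (f.continuous.isClosedMap _ O.isOpen.isClosed_compl).isOpen_compl⟩, ?_, ?_⟩
       · rintro y hy ⟨x, hx, rfl⟩
         exact hx (hO hy)
       · intro B hB
         refine hO' _ fun x hx => ?_
         by_contra hxO
         exact hB hx ⟨x, hxO, rfl⟩ },
    isPossibility_of_sup _ fun F G => (ν.map_sup (pre f F) (pre f G)).le⟩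

theorem map_continuous (f : C(X, Y)) : Continuous (map f) := by
  refine continuous_of _ (fun F a => ?_) fun U a => ?_
  · exact isOpen_lt (pre f F) a
  convert isOpen_gt (U.comap f) a using 1
  ext ν
  simp only [Set.mem_ofPred_eq, Capacity.lt_onOpen]
  constructor
  · rintro ⟨K, hK, h⟩
    exact ⟨pre f K, fun x hx => hK hx, h⟩
  · rintro ⟨K, hK, h⟩
    refine ⟨⟨f '' K, f.continuous.isClosedMap _ K.isClosed⟩, ?_, h.trans_le ?_⟩
    · rintro _ ⟨x, hx, rfl⟩; exact hK hx
    · exact ν.1.mono K (pre f _) fun x hx => ⟨x, hx, rfl⟩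

/-! ### The unit and the multiplication -/

open Classical in
/-- The unit: `ηX(x)(F) = 1` if `x ∈ F`, and `0` otherwise. -/
noncomputable def unit (x : X) : Poss X :=
  ⟨{ toFun := fun F => if x ∈ F then 1 else 0
     map_univ := if_pos (show x ∈ (⊤ : Closeds X) from trivial)
     map_empty := if_neg (show x ∉ (⊥ : Closeds X) from fun h => h)
     mono := by
       intro F G h
       split_ifs with h1 h2
       exacts [le_rfl, absurd (h h1) h2, bot_le, le_rfl]
     usc := by
       intro F a h
       split_ifs at h with h1
       · exact absurd h (not_lt.2 le_top)
       · refine ⟨⟨{x}ᶜ, isOpen_compl_singleton⟩, ?_, fun B hB => ?_⟩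
         · rintro y hy rfl
           exact h1 hy
         · rw [if_neg fun hx : x ∈ B => hB hx rfl]
           exact h },
    isPossibility_of_sup _ fun F G => by
      change (if x ∈ F ⊔ G then (1 : I) else 0) ≤
        (if x ∈ F then 1 else 0) ⊔ (if x ∈ G then 1 else 0)
      by_cases hF : x ∈ F
      · rw [if_pos hF]; exact le_trans le_top le_sup_left
      · by_cases hG : x ∈ G
        · rw [if_pos hG]; exact le_trans le_top le_sup_right
        · rw [if_neg fun h : x ∈ F ⊔ G => h.elim hF hG]; exact bot_le⟩

theorem unit_apply_of_mem {x : X} {F : Closeds X} (h : x ∈ F) : unit x F = 1 := if_pos h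

theorem unit_apply_of_notMem {x : X} {F : Closeds X} (h : x ∉ F) : unit x F = 0 := if_neg h

theorem unit_continuous : Continuous (unit : X → Poss X) := by
  refine continuous_of _ (fun F a => ?_) fun U a => ?_
  · rcases eq_or_lt_of_le (show 0 ≤ a from bot_le) with rfl | ha
    · convert isOpen_empty using 1
      ext x
      exact ⟨fun h => absurd (show unit x F < 0 from h) (not_lt.2 bot_le), fun h => h.elim⟩
    · convert F.isClosed.isOpen_compl using 1
      ext x
      by_cases h : x ∈ F
      · exact ⟨fun h' => absurd ((unit_apply_of_mem h).symm.trans_lt h') (not_lt.2 le_top),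
          fun h' => absurd h h'⟩
      · exact ⟨fun _ => h, fun _ => (unit_apply_of_notMem h).trans_lt ha⟩
  · rcases eq_or_lt_of_le (show a ≤ 1 from le_top) with rfl | ha
    · convert isOpen_empty using 1
      ext x
      exact ⟨fun h => absurd (show 1 < (unit x).1.onOpen U from h) (not_lt.2 le_top),
        fun h => h.elim⟩
    · convert U.isOpen using 1
      ext x
      constructor
      · intro h
        obtain ⟨K, hK, h⟩ := Capacity.lt_onOpen.1 h
        by_contra hx
        rw [unit_apply_of_notMem fun h' => hx (hK h')] at h
        exact absurd h (not_lt.2 bot_le)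
      · intro h
        refine Capacity.lt_onOpen.2 ⟨pt x, Set.singleton_subset_iff.2 h, ?_⟩
        rw [unit_apply_of_mem (pt_le.1 le_rfl)]
        exact ha

/-- The value `sup {C(F_t) ∗ t | t ∈ (0,1]}`, where `F_t = {ν ∈ ΠX | ν(F) ≥ t}`; the supremum is a
maximum, see `isGreatest_mulVal`. -/
noncomputable def mulVal (T : ContinuousTNorm) (C : Poss (Poss X)) (F : Closeds X) : I :=
  ⨆ t : Set.Ioc (0 : I) 1, T.op (C (superlevel (fun ν : Poss X => ν F) (usc_eval F) t.1)) t.1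

theorem mulVal_eq (T : ContinuousTNorm) (C : Poss (Poss X)) (F : Closeds X) :
    mulVal T C F = ⨆ ν, T.op (C (pt ν)) (ν F) := by
  rw [← iSup_superlevel T C _ (usc_eval F), mulVal]
  exact iSup_pos T fun t => C (superlevel (fun ν : Poss X => ν F) (usc_eval F) t)

theorem isGreatest_mulVal (T : ContinuousTNorm) (C : Poss (Poss X)) (F : Closeds X) :
    IsGreatest {r | ∃ t ∈ Set.Ioc (0 : I) 1,
      T.op (C (superlevel (fun ν : Poss X => ν F) (usc_eval F) t)) t = r} (mulVal T C F) := by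
  have hle : ∀ t ∈ Set.Ioc (0 : I) 1,
      T.op (C (superlevel (fun ν : Poss X => ν F) (usc_eval F) t)) t ≤ mulVal T C F := fun t ht =>
    le_iSup (fun t : Set.Ioc (0 : I) 1 =>
      T.op (C (superlevel (fun ν : Poss X => ν F) (usc_eval F) t.1)) t.1) ⟨t, ht⟩
  refine ⟨?_, ?_⟩
  · obtain ⟨ν, hν⟩ := exists_eq_iSup T C _ (usc_eval F)
    rw [← mulVal_eq] at hν
    rcases eq_or_lt_of_le (show 0 ≤ ν F from bot_le) with h | h
    · have h1 : (1 : I) ∈ Set.Ioc (0 : I) 1 := ⟨zero_lt_one, le_rfl⟩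
      rw [← h, T.op_zero] at hν
      exact ⟨1, h1, le_antisymm (hle 1 h1) (hν.symm.le.trans bot_le)⟩
    · refine ⟨ν F, ⟨h, le_top⟩, le_antisymm (hle _ ⟨h, le_top⟩) ?_⟩
      exact hν.symm.le.trans (T.op_le_op (C.mono (pt_le.2 (le_refl (ν F)))) le_rfl)
  · rintro _ ⟨t, ht, rfl⟩
    exact hle t ht

theorem mulVal_lt {T : ContinuousTNorm} {C : Poss (Poss X)} {F : Closeds X} {a : I}
    (h : mulVal T C F < a) (ν : Poss X) : T.op (C (pt ν)) (ν F) < a := by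
  rw [mulVal_eq] at h
  exact (le_iSup (fun ν : Poss X => T.op (C (pt ν)) (ν F)) ν).trans_lt h

/-- The multiplication `μX(C)(F) = max {C(F_t) ∗ t | t ∈ (0,1]}`. -/
noncomputable def mul (T : ContinuousTNorm) (C : Poss (Poss X)) : Poss X :=
  ⟨{ toFun := mulVal T C
     map_univ := by
       refine le_antisymm le_top ?_
       have h : superlevel (fun ν : Poss X => ν ⊤) (usc_eval ⊤) 1 = ⊤ := by
         refine top_le_iff.1 fun ν _ => ?_
         exact ν.1.map_univ.ge
       refine le_trans ?_ (le_iSup (fun t : Set.Ioc (0 : I) 1 => T.op (C (superlevel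
         (fun ν : Poss X => ν ⊤) (usc_eval ⊤) t.1)) t.1) ⟨1, zero_lt_one, le_rfl⟩)
       rw [h, C.1.map_univ, T.op_one]
     map_empty := by
       rw [mulVal_eq]
       refine le_antisymm (iSup_le fun ν => ?_) bot_le
       rw [ν.1.map_empty, T.op_zero]
     mono := fun F G h => by
       rw [mulVal_eq, mulVal_eq]
       exact iSup_mono fun ν => T.op_le_op le_rfl (ν.mono h)
     usc := by
       intro F a h
       have h0 : 0 < a := lt_of_le_of_lt bot_le h
       -- find a closed neighbourhood of `F` that works for all `ν`
       have key := isCompact_univ (X := Poss X).induction_on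
         (p := fun s => ∃ b < a, ∃ O : Opens X, (F : Set X) ⊆ O ∧
           ∀ B : Closeds X, (B : Set X) ⊆ O → ∀ ν ∈ s, T.op (C (pt ν)) (ν B) ≤ b)
         ⟨0, h0, ⊤, fun _ _ => trivial, by simp⟩
         (by
           rintro s t hst ⟨b, hb, O, hO, H⟩
           exact ⟨b, hb, O, hO, fun B hB ν hν => H B hB ν (hst hν)⟩)
         (by
           rintro s t ⟨b, hb, O, hO, H⟩ ⟨b', hb', O', hO', H'⟩
           refine ⟨b ⊔ b', max_lt hb hb', O ⊓ O', Set.subset_inter hO hO', fun B hB ν hν => ?_⟩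
           rcases hν with hν | hν
           · exact (H B (hB.trans Set.inter_subset_left) ν hν).trans le_sup_left
           · exact (H' B (hB.trans Set.inter_subset_right) ν hν).trans le_sup_right)
         (by
           intro ν _
           obtain ⟨r, s, hrs, hr, hs⟩ := T.exists_gt (mulVal_lt h ν)
           have hC : ∀ᶠ ν' in nhds ν, C (pt ν') ≤ r := by
             rcases hr with hr | rfl
             · obtain ⟨O, hO, hO'⟩ := C.1.usc (pt ν) r hr
               filter_upwards [O.isOpen.mem_nhds (hO (Set.mem_singleton ν))] with ν' hν'
               exact (hO' (pt ν') (Set.singleton_subset_iff.2 hν')).le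
             · exact Filter.Eventually.of_forall fun _ => le_top
           rcases hs with hs | rfl
           · obtain ⟨O, hO, hO'⟩ := ν.1.usc F s hs
             obtain ⟨V, D, hFV, hVD, hDO⟩ := exists_closed_between hO
             refine ⟨{ν' | C (pt ν') ≤ r} ∩ {ν' | ν' D < s}, mem_nhdsWithin_of_mem_nhds
               (Filter.inter_mem hC ((isOpen_lt D s).mem_nhds (hO' D hDO))), T.op r s, hrs, V,
               hFV, ?_⟩
             intro B hB ν' hν'
             exact T.op_le_op hν'.1 ((ν'.mono (hB.trans hVD)).trans (le_of_lt hν'.2))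
           · exact ⟨{ν' | C (pt ν') ≤ r}, mem_nhdsWithin_of_mem_nhds hC, T.op r 1, hrs, ⊤,
               fun _ _ => trivial, fun B _ ν' hν' => T.op_le_op hν' le_top⟩)
       obtain ⟨b, hb, O, hO, H⟩ := key
       refine ⟨O, hO, fun B hB => ?_⟩
       rw [mulVal_eq]
       exact (iSup_le fun ν => H B hB ν trivial).trans_lt hb },
    isPossibility_of_sup _ fun F G => by
      change mulVal T C (F ⊔ G) ≤ mulVal T C F ⊔ mulVal T C G
      rw [mulVal_eq, mulVal_eq, mulVal_eq]
      refine iSup_le fun ν => ?_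
      rw [ν.map_sup, T.op_sup]
      exact sup_le_sup (le_iSup (fun ν : Poss X => T.op (C (pt ν)) (ν F)) ν)
        (le_iSup (fun ν : Poss X => T.op (C (pt ν)) (ν G)) ν)⟩

theorem mul_apply (T : ContinuousTNorm) (C : Poss (Poss X)) (F : Closeds X) :
    mul T C F = ⨆ ν, T.op (C (pt ν)) (ν F) := mulVal_eq T C F

theorem mul_continuous (T : ContinuousTNorm) :
    Continuous (mul T : Poss (Poss X) → Poss X) := by
  refine continuous_of _ (fun F a => ?_) fun U a => ?_
  · refine isOpen_iff_mem_nhds.2 fun C hC => ?_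
    obtain ⟨b, hb, H⟩ := exists_cover T C _ (usc_eval F) a (mulVal_lt hC)
    filter_upwards [H] with C' hC'
    rw [mul_apply]
    exact (iSup_le hC').trans_lt hb
  · refine isOpen_iff_mem_nhds.2 fun C hC => ?_
    obtain ⟨K, hK, hlt⟩ := Capacity.lt_onOpen.1 hC
    change a < mul T C K at hlt
    rw [mul_apply, lt_iSup_iff] at hlt
    obtain ⟨ν, hν⟩ := hlt
    obtain ⟨r, s, hrs, hr, hs⟩ := T.exists_lt hν
    obtain ⟨V, B, hKV, hVB, hBU⟩ := exists_closed_between hK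
    let W : Opens (Poss X) := ⟨_, isOpen_gt V s⟩
    have hνW : ν ∈ W := Capacity.lt_onOpen.2 ⟨K, hKV, hs⟩
    have hCW : r < C.1.onOpen W :=
      Capacity.lt_onOpen.2 ⟨pt ν, Set.singleton_subset_iff.2 hνW, hr⟩
    filter_upwards [(isOpen_gt W r).mem_nhds hCW] with C' hC'
    obtain ⟨𝒦, h𝒦, hlt⟩ := Capacity.lt_onOpen.1 hC'
    obtain ⟨ν', hν', hlt'⟩ := exists_pt hlt
    obtain ⟨L, hL, hlt''⟩ := Capacity.lt_onOpen.1 (show s < ν'.1.onOpen V from h𝒦 hν')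
    refine Capacity.lt_onOpen.2 ⟨B, hBU, ?_⟩
    rw [mul_apply]
    refine hrs.trans_le (le_iSup_of_le ν' (T.op_le_op hlt'.le ?_))
    exact hlt''.le.trans (ν'.mono (hL.trans hVB))

/-! ### The monad laws for possibility capacities -/

theorem map_unit (f : C(X, Y)) (x : X) : map f (unit x) = unit (f x) := by
  refine ext fun F => ?_
  by_cases h : f x ∈ F
  · rw [unit_apply_of_mem h]; exact unit_apply_of_mem (F := pre f F) h
  · rw [unit_apply_of_notMem h]; exact unit_apply_of_notMem (F := pre f F) h

theorem map_mul (T : ContinuousTNorm) (f : C(X, Y)) (C : Poss (Poss X)) :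
    map f (mul T C) = mul T (map ⟨map f, map_continuous f⟩ C) :=
  ext fun _ => rfl

theorem mul_map (T : ContinuousTNorm) (g : C(Y, Poss X)) (D : Poss Y) (F : Closeds X) :
    mul T (map g D) F = ⨆ y, T.op (D (pt y)) (g y F) := by
  have hg : UpperSemicontinuous fun y => g y F :=
    upperSemicontinuous_iff_isOpen_preimage.2 fun a => (isOpen_lt F a).preimage g.continuous
  rw [← iSup_superlevel T D _ hg]
  exact iSup_pos T fun t => D (superlevel (fun y => g y F) hg t)

theorem mul_unit (T : ContinuousTNorm) (ν : Poss X) : mul T (unit ν) = ν := by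
  refine ext fun F => ?_
  rw [mul_apply]
  apply le_antisymm
  · refine iSup_le fun ν' => ?_
    by_cases h : ν = ν'
    · subst h; exact T.op_le_right _ _
    · rw [unit_apply_of_notMem (F := pt ν') h, T.zero_op]; exact bot_le
  · refine le_iSup_of_le ν ?_
    rw [unit_apply_of_mem (pt_le.1 le_rfl), T.one_op]

theorem mul_map_unit (T : ContinuousTNorm) (ν : Poss X) :
    mul T (map ⟨unit, unit_continuous⟩ ν) = ν := by
  refine ext fun F => ?_
  rw [mul_map, eq_iSup ν F]
  apply le_antisymm
  · refine iSup_le fun x => ?_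
    by_cases h : x ∈ F
    · exact le_iSup_of_le ⟨x, h⟩ (T.op_le_left _ _)
    · refine le_trans ?_ bot_le
      change T.op _ (unit x F) ≤ 0
      rw [unit_apply_of_notMem h, T.op_zero]
  · refine iSup_le fun x => le_iSup_of_le x.1 ?_
    change _ ≤ T.op _ (unit x.1 F)
    rw [unit_apply_of_mem x.2, T.op_one]

theorem mul_assoc (T : ContinuousTNorm) (D : Poss (Poss (Poss X))) :
    mul T (map ⟨mul T, mul_continuous T⟩ D) = mul T (mul T D) := by
  refine ext fun F => ?_
  rw [mul_map, mul_apply T (mul T D)]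
  simp only [mul_apply, ContinuousMap.coe_mk, T.op_iSup, T.iSup_op, T.op_assoc]
  exact iSup_comm

end compact

end Poss

/-- The functor `Π` on compact Hausdorff spaces. -/
def possFunctor : CompHaus.{u} ⥤ CompHaus.{u} where
  obj X := CompHaus.of (Poss X)
  map f := CompHausLike.ofHom _ ⟨Poss.map f.hom.hom, Poss.map_continuous f.hom.hom⟩
  map_id _ := by ext ν; exact Poss.ext fun _ => rfl
  map_comp _ _ := by ext ν; exact Poss.ext fun _ => rfl

/-- The possibility-capacity monad `(Π, η, μ_∗)`. -/
noncomputable def possMonad (T : ContinuousTNorm) : Monad CompHaus.{u} where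
  toFunctor := possFunctor
  η :=
    { app := fun X => CompHausLike.ofHom _ ⟨Poss.unit, Poss.unit_continuous⟩
      naturality := fun X Y f => by
        ext x; exact (Poss.map_unit f.hom.hom x).symm }
  μ :=
    { app := fun X => CompHausLike.ofHom _ ⟨Poss.mul T, Poss.mul_continuous T⟩
      naturality := fun X Y f => by
        ext C; exact (Poss.map_mul T f.hom.hom C).symm }
  assoc X := by ext D; exact Poss.mul_assoc T D
  left_unit X := by ext ν; exact Poss.mul_unit T ν
  right_unit X := by ext ν; exact Poss.mul_map_unit T ν

/-! ### The monad of `∗`-measures -/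

/-- The function `c_X ∗ φ`. -/
def ContinuousTNorm.scale (T : ContinuousTNorm) {X : Type u} [TopologicalSpace X] (c : I)
    (φ : C(X, I)) : C(X, I) where
  toFun x := T.op c (φ x)
  continuous_toFun := T.op_continuous.comp (by fun_prop : Continuous fun x => (c, φ x))

/-- A functional `C(X,[0,1]) → [0,1]` is a `∗`-measure if it is normed, preserves finite maxima and
is `∗`-homogeneous. -/
structure IsStarMeasure (T : ContinuousTNorm) {X : Type u} [TopologicalSpace X]
    (m : C(X, I) → I) : Prop where
  map_one : m (ContinuousMap.const X 1) = 1
  map_sup : ∀ φ ψ, m (φ ⊔ ψ) = m φ ⊔ m ψ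
  map_scale : ∀ c φ, m (T.scale c φ) = T.op c (m φ)

/-- The space `A^∗X` of `∗`-measures, with the topology of the product `[0,1]^{C(X,[0,1])}`. -/
def StarMeasure (T : ContinuousTNorm) (X : Type u) [TopologicalSpace X] : Type u :=
  {m : C(X, I) → I // IsStarMeasure T m}

namespace StarMeasure

variable {T : ContinuousTNorm} {X Y : Type u} [TopologicalSpace X] [TopologicalSpace Y]

instance : CoeFun (StarMeasure T X) fun _ => C(X, I) → I := ⟨fun m => m.1⟩

instance : TopologicalSpace (StarMeasure T X) :=
  inferInstanceAs (TopologicalSpace {m : C(X, I) → I // IsStarMeasure T m})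

instance : T2Space (StarMeasure T X) :=
  inferInstanceAs (T2Space {m : C(X, I) → I // IsStarMeasure T m})

theorem ext {m m' : StarMeasure T X} (h : ∀ φ, m φ = m' φ) : m = m' := Subtype.ext (funext h)

theorem continuous_eval (φ : C(X, I)) : Continuous fun m : StarMeasure T X => m φ :=
  (continuous_apply φ).comp continuous_subtype_val

theorem continuous_of {Z : Type*} [TopologicalSpace Z] (g : Z → StarMeasure T X)
    (h : ∀ φ, Continuous fun z => g z φ) : Continuous g :=
  Continuous.subtype_mk (p := IsStarMeasure T) (f := fun z => (g z).1) (continuous_pi h) _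

instance : CompactSpace (StarMeasure T X) := by
  have hc : IsClosed {m : C(X, I) → I | IsStarMeasure T m} := by
    have : {m : C(X, I) → I | IsStarMeasure T m} =
        {m | m (ContinuousMap.const X 1) = 1} ∩ ((⋂ φ, ⋂ ψ, {m | m (φ ⊔ ψ) = m φ ⊔ m ψ}) ∩
          ⋂ c, ⋂ φ, {m | m (T.scale c φ) = T.op c (m φ)}) := by
      ext m
      simp only [Set.mem_inter_iff, Set.mem_iInter, Set.mem_ofPred_eq]
      exact ⟨fun h => ⟨h.1, h.2, h.3⟩, fun h => ⟨h.1, h.2.1, h.2.2⟩⟩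
    rw [this]
    refine (isClosed_eq (continuous_apply _) continuous_const).inter (IsClosed.inter ?_ ?_)
    · refine isClosed_iInter fun φ => isClosed_iInter fun ψ => isClosed_eq (continuous_apply _) ?_
      exact (continuous_apply φ).sup (continuous_apply ψ)
    · refine isClosed_iInter fun c => isClosed_iInter fun φ => isClosed_eq (continuous_apply _) ?_
      exact T.op_continuous.comp (continuous_const.prodMk (continuous_apply φ))
  exact isCompact_iff_compactSpace.1 hc.isCompact

/-- The projection `π_φ : A^∗X → [0,1]`. -/
def proj (φ : C(X, I)) : C(StarMeasure T X, I) := ⟨fun m => m φ, continuous_eval φ⟩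

/-- The map `A^∗f`, with `π_φ ∘ A^∗f = π_{φ ∘ f}`. -/
def map (f : C(X, Y)) (m : StarMeasure T X) : StarMeasure T Y :=
  ⟨fun φ => m (φ.comp f), m.2.map_one, fun φ ψ => m.2.map_sup (φ.comp f) (ψ.comp f),
    fun c φ => m.2.map_scale c (φ.comp f)⟩

theorem map_continuous (f : C(X, Y)) : Continuous (map f : StarMeasure T X → StarMeasure T Y) :=
  continuous_of _ fun φ => continuous_eval (φ.comp f)

/-- The unit, with `π_φ ∘ hX = φ`: the Dirac measure at `x`. -/
def unit (x : X) : StarMeasure T X :=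
  ⟨fun φ => φ x, rfl, fun _ _ => rfl, fun _ _ => rfl⟩

theorem unit_continuous : Continuous (unit : X → StarMeasure T X) :=
  continuous_of _ fun φ => φ.continuous

/-- The multiplication, with `π_φ ∘ mX = π(π_φ)`. -/
def mul (M : StarMeasure T (StarMeasure T X)) : StarMeasure T X :=
  ⟨fun φ => M (proj φ),
    by
      rw [show proj (ContinuousMap.const X 1) = ContinuousMap.const (StarMeasure T X) 1 from
        ContinuousMap.ext fun m => m.2.map_one]
      exact M.2.map_one,
    fun φ ψ => by
      rw [show proj (φ ⊔ ψ) = (proj φ ⊔ proj ψ : C(StarMeasure T X, I)) from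
        ContinuousMap.ext fun m => m.2.map_sup φ ψ]
      exact M.2.map_sup _ _,
    fun c φ => by
      rw [show proj (T.scale c φ) = (T.scale c (proj φ) : C(StarMeasure T X, I)) from
        ContinuousMap.ext fun m => m.2.map_scale c φ]
      exact M.2.map_scale _ _⟩

theorem mul_continuous :
    Continuous (mul : StarMeasure T (StarMeasure T X) → StarMeasure T X) :=
  continuous_of _ fun φ => continuous_eval (proj φ)

end StarMeasure

/-- The functor `A^∗` on compact Hausdorff spaces. -/
def starFunctor (T : ContinuousTNorm) : CompHaus.{u} ⥤ CompHaus.{u} where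
  obj X := CompHaus.of (StarMeasure T X)
  map f := CompHausLike.ofHom _ ⟨StarMeasure.map f.hom.hom, StarMeasure.map_continuous f.hom.hom⟩

/-- The monad `(A^∗, h, m)` of `∗`-measures. -/
def starMonad (T : ContinuousTNorm) : Monad CompHaus.{u} where
  toFunctor := starFunctor T
  η := { app := fun X => CompHausLike.ofHom _ ⟨StarMeasure.unit, StarMeasure.unit_continuous⟩ }
  μ := { app := fun X => CompHausLike.ofHom _ ⟨StarMeasure.mul, StarMeasure.mul_continuous⟩ }

/-! ### The t-normed integral -/

/-- The closed set `φ_t = φ⁻¹([t,1])`. -/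
def upperSet {X : Type u} [TopologicalSpace X] (φ : C(X, I)) (t : I) : Closeds X :=
  ⟨φ ⁻¹' Set.Icc t 1, isClosed_Icc.preimage φ.continuous⟩

/-- The t-normed integral `sup {ν(φ_t) ∗ t | t ∈ [0,1]}`; the supremum is a maximum, see
`isGreatest_tNormedIntegral`. -/
noncomputable def tNormedIntegral (T : ContinuousTNorm) {X : Type u} [TopologicalSpace X]
    (ν : Capacity X) (φ : C(X, I)) : I :=
  ⨆ t : I, T.op (ν (upperSet φ t)) t

theorem isGreatest_tNormedIntegral (T : ContinuousTNorm) {X : Type u} [TopologicalSpace X]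
    [CompactSpace X] [T2Space X] (ν : Poss X) (φ : C(X, I)) :
    IsGreatest {r | ∃ t : I, T.op (ν (upperSet φ t)) t = r} (tNormedIntegral T ν.1 φ) := by
  have h : ∀ t, upperSet φ t = superlevel φ φ.continuous.upperSemicontinuous t := fun t =>
    SetLike.ext fun x => ⟨fun hx : φ x ∈ Set.Icc t 1 => hx.1,
      fun hx => show φ x ∈ Set.Icc t 1 from ⟨hx, le_top⟩⟩
  have hle : ∀ t, T.op (ν (upperSet φ t)) t ≤ tNormedIntegral T ν.1 φ := fun t =>
    le_iSup (fun t => T.op (ν (upperSet φ t)) t) t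
  refine ⟨?_, by rintro _ ⟨t, rfl⟩; exact hle t⟩
  obtain ⟨x, hx⟩ := Poss.exists_eq_iSup T ν φ φ.continuous.upperSemicontinuous
  refine ⟨φ x, le_antisymm (hle _) ?_⟩
  rw [← Poss.iSup_superlevel T ν φ φ.continuous.upperSemicontinuous] at hx
  simp only [← h] at hx
  exact hx.symm.le.trans (T.op_le_op (ν.mono (Poss.pt_le.2 ⟨le_rfl, le_top⟩)) le_rfl)

end PossibilityMonad

/-! A possibility capacity on a compactum is determined by its values at points, and its integral is
the supremum over `x` of `ν {x} ∗ φ x` (`tNormedIntegral_eq`). Since `∗` distributes over suprema in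
each variable, the algebraic claims become manipulations of suprema. In particular, both sides of
the multiplication law are the double supremum of `D {ν} ∗ ν {x} ∗ φ x`, taken in the two possible
orders (`integralMeasure_mul`).

Injectivity comes from Urysohn functions, which squeeze the integral between the value at a point
and the value on a closed neighbourhood. For surjectivity, a `∗`-measure `m` gives the set function
`F ↦ inf {m φ | φ = 1 on F}`. Joint continuity of `∗` near `(1, a)` makes it upper semicontinuous
(`StarMeasure.exists_eq_one_on_open`), and maxima of test functions make it a possibility capacity.
Its integral is at most `m` by homogeneity (`StarMeasure.op_outerVal_upperSet_le`) and at least `m`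
by compactness (`StarMeasure.le_of_forall_pt_lt`).

The map is therefore a continuous bijection of compacta, hence a homeomorphism. -/

namespace PossibilityMonad

/-! ### Separating functions -/

section urysohn

variable {X : Type u} [TopologicalSpace X] [NormalSpace X]

/-- Urysohn's lemma for a closed set inside an open set, with values in `[0,1]`. -/
theorem exists_eq_one_eq_zero {F : Closeds X} {O : Opens X} (h : (F : Set X) ⊆ O) :
    ∃ φ : C(X, I), (∀ x ∈ F, φ x = 1) ∧ ∀ x ∉ O, φ x = 0 := by
  obtain ⟨f, hf0, hf1, hf⟩ := exists_continuous_zero_one_of_isClosed O.isOpen.isClosed_compl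
    F.isClosed (Set.disjoint_left.2 fun x hx hF => hx (h hF))
  exact ⟨⟨fun x => ⟨f x, hf x⟩, f.continuous.subtype_mk hf⟩,
    fun x hx => Subtype.ext (hf1 hx), fun x hx => Subtype.ext (hf0 hx)⟩

/-- The open set `{x | t < φ x}`. -/
def openSuperlevel (φ : C(X, I)) (t : I) : Opens X :=
  ⟨{x | t < φ x}, isOpen_lt continuous_const φ.continuous⟩

end urysohn

/-! ### The integral as a continuous, injective morphism of monads -/

section integral

theorem upperSet_eq_superlevel {X : Type u} [TopologicalSpace X] (φ : C(X, I)) (t : I) :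
    upperSet φ t = superlevel φ φ.continuous.upperSemicontinuous t :=
  SetLike.ext fun x => ⟨fun hx : φ x ∈ Set.Icc t 1 => hx.1,
    fun hx => show φ x ∈ Set.Icc t 1 from ⟨hx, le_top⟩⟩

theorem mem_upperSet {X : Type u} [TopologicalSpace X] {φ : C(X, I)} {t : I} {x : X} :
    x ∈ upperSet φ t ↔ t ≤ φ x := by
  rw [upperSet_eq_superlevel]; rfl

/-- Layer-cake formula: the capacity of a superlevel set is the supremum over its points, and the
best level at `x` is `φ x` itself. -/
theorem tNormedIntegral_eq (T : ContinuousTNorm) {X : Type u} [TopologicalSpace X] [T1Space X]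
    (ν : Poss X) (φ : C(X, I)) :
    tNormedIntegral T ν.1 φ = ⨆ x, T.op (ν (Poss.pt x)) (φ x) := by
  rw [← Poss.iSup_superlevel T ν φ φ.continuous.upperSemicontinuous]
  simp only [← upperSet_eq_superlevel]
  rfl

variable {X Y : Type u} [TopologicalSpace X] [CompactSpace X] [T2Space X]
  [TopologicalSpace Y] [CompactSpace Y] [T2Space Y]

theorem isStarMeasure_tNormedIntegral (T : ContinuousTNorm) {X : Type u} [TopologicalSpace X]
    [T1Space X] (ν : Poss X) :
    IsStarMeasure T (tNormedIntegral T ν.1) where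
  map_one := by
    rw [tNormedIntegral_eq]
    simp only [ContinuousMap.const_apply, T.op_one]
    -- The layer-cake identity for the constant function 1, read from right to left, bounds the
    -- supremum of the point values below by `ν ⊤ = 1`.
    have := Poss.iSup_superlevel T ν (fun _ => 1) upperSemicontinuous_const
    simp only [T.op_one] at this
    rw [← this]
    refine le_antisymm le_top (le_iSup_of_le 1 ?_)
    rw [T.op_one, show superlevel (fun _ : X => (1 : I)) upperSemicontinuous_const 1 = ⊤ from
      top_le_iff.1 fun _ _ => le_refl (1 : I), ν.1.map_univ]
  map_sup φ ψ := by
    simp only [tNormedIntegral_eq, ContinuousMap.sup_apply, T.op_sup]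
    exact iSup_sup_eq
  map_scale c φ := by
    simp only [tNormedIntegral_eq, T.op_iSup]
    refine iSup_congr fun x => ?_
    change T.op _ (T.op c _) = _
    rw [← T.op_assoc, ← T.op_assoc, T.op_comm c]

theorem continuous_tNormedIntegral (T : ContinuousTNorm) (φ : C(X, I)) :
    Continuous fun ν : Poss X => tNormedIntegral T ν.1 φ := by
  simp only [tNormedIntegral_eq]
  refine OrderTopology.continuous_iff.2 fun a =>
    ⟨isOpen_iff_mem_nhds.2 fun ν hν => ?_, isOpen_iff_mem_nhds.2 fun ν hν => ?_⟩
  -- Lower bounds persist: both factors shrink to `r < ν {x}` and `s < φ x` with `a < r ∗ s`. A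
  -- capacity exceeding `r` on the open set `{φ > s}` exceeds `r` at one of its points.
  · obtain ⟨x, hx⟩ := lt_iSup_iff.1 (show a < ⨆ x, T.op (ν (Poss.pt x)) (φ x) from hν)
    obtain ⟨r, s, hrs, hr, hs⟩ := T.exists_lt hx
    have hU : r < ν.1.onOpen (openSuperlevel φ s) :=
      Capacity.lt_onOpen.2 ⟨Poss.pt x, Set.singleton_subset_iff.2 hs, hr⟩
    filter_upwards [(Poss.isOpen_gt _ r).mem_nhds hU] with c hc
    obtain ⟨K, hK, hlt⟩ := Capacity.lt_onOpen.1 hc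
    obtain ⟨y, hy, hy'⟩ := Poss.exists_pt hlt
    exact hrs.trans_le (le_iSup_of_le y (T.op_le_op hy'.le (le_of_lt (hK hy))))
  -- Pointwise bounds below `a` could still have supremum `a`; the uniform bound `b < a` rules this
  -- out.
  · obtain ⟨b, hb, H⟩ := Poss.exists_cover T ν φ φ.continuous.upperSemicontinuous a fun x =>
      (le_iSup (fun x => T.op (ν (Poss.pt x)) (φ x)) x).trans_lt hν
    filter_upwards [H] with c hc
    exact (iSup_le hc).trans_lt hb

/-- The map `lX : ΠX → A^∗X` that sends a possibility capacity to its t-normed integral. -/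
noncomputable def integralMeasure (T : ContinuousTNorm) (ν : Poss X) : StarMeasure T X :=
  ⟨tNormedIntegral T ν.1, isStarMeasure_tNormedIntegral T ν⟩

theorem integralMeasure_apply (T : ContinuousTNorm) (ν : Poss X) (φ : C(X, I)) :
    integralMeasure T ν φ = ⨆ x, T.op (ν (Poss.pt x)) (φ x) := tNormedIntegral_eq T ν φ

theorem integralMeasure_continuous (T : ContinuousTNorm) :
    Continuous (integralMeasure T : Poss X → StarMeasure T X) :=
  StarMeasure.continuous_of _ (continuous_tNormedIntegral T)

/-- Definitional, because the superlevel sets of `φ ∘ f` are the preimages under `f` of those of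
`φ`. -/
theorem integralMeasure_map (T : ContinuousTNorm) (f : C(X, Y)) (ν : Poss X) :
    integralMeasure T (Poss.map f ν) = StarMeasure.map f (integralMeasure T ν) :=
  StarMeasure.ext fun _ => rfl

theorem integralMeasure_unit (T : ContinuousTNorm) (x : X) :
    integralMeasure T (Poss.unit x) = StarMeasure.unit x := by
  refine StarMeasure.ext fun φ => ?_
  rw [integralMeasure_apply]
  change _ = φ x
  apply le_antisymm
  · refine iSup_le fun y => ?_
    by_cases h : x = y
    · subst h; exact T.op_le_right _ _
    · rw [Poss.unit_apply_of_notMem (F := Poss.pt y) h, T.zero_op]; exact bot_le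
  · refine le_iSup_of_le x ?_
    rw [Poss.unit_apply_of_mem (Poss.pt_le.1 le_rfl), T.one_op]

/-- The t-normed integral with respect to a push-forward, in pointwise form. -/
theorem tNormedIntegral_map (T : ContinuousTNorm) (f : C(X, Y)) (ν : Poss X) (φ : C(Y, I)) :
    tNormedIntegral T (Poss.map f ν).1 φ = ⨆ x, T.op (ν (Poss.pt x)) (φ (f x)) :=
  tNormedIntegral_eq T ν (φ.comp f)

theorem integralMeasure_mul (T : ContinuousTNorm) (D : Poss (Poss X)) :
    integralMeasure T (Poss.mul T D) = StarMeasure.mul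
      (integralMeasure T (Poss.map ⟨integralMeasure T, integralMeasure_continuous T⟩ D)) := by
  refine StarMeasure.ext fun φ => ?_
  rw [integralMeasure_apply]
  -- The push-forward form takes the supremum over `ν` in `ΠX` rather than over points of `A^∗X`, so
  -- it matches the supremum in `Poss.mul_apply`.
  refine Eq.trans ?_ (tNormedIntegral_map T _ D (StarMeasure.proj φ)).symm
  change _ = ⨆ ν : Poss X, T.op (D (Poss.pt ν)) (integralMeasure T ν φ)
  simp only [integralMeasure_apply, Poss.mul_apply, T.op_iSup, T.iSup_op, T.op_assoc]
  exact iSup_comm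

/-- Values at points suffice. If `ν {x} < a < ν' {x}`, then `x` has a closed neighbourhood `B` with
`ν B < a`. A Urysohn function equal to 1 at `x` and supported in `B` has `ν`-integral at most `ν B`
and `ν'`-integral at least `ν' {x}`. -/
theorem integralMeasure_injective (T : ContinuousTNorm) :
    Function.Injective (integralMeasure T : Poss X → StarMeasure T X) := by
  have key : ∀ ν ν' : Poss X, integralMeasure T ν = integralMeasure T ν' →
      ∀ x, ν' (Poss.pt x) ≤ ν (Poss.pt x) := by
    intro ν ν' h x
    by_contra! hlt
    obtain ⟨a, ha, ha'⟩ := exists_between hlt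
    obtain ⟨O, hO, hO'⟩ := ν.1.usc _ a ha
    obtain ⟨V, B, hxV, hVB, hBO⟩ := Poss.exists_closed_between hO
    obtain ⟨φ, hφ1, hφ0⟩ := exists_eq_one_eq_zero hxV
    have h1 : integralMeasure T ν φ ≤ ν B := by
      rw [integralMeasure_apply]
      refine iSup_le fun y => ?_
      by_cases hy : y ∈ V
      · exact (T.op_le_left _ _).trans (ν.mono (Poss.pt_le.2 (hVB hy)))
      · rw [hφ0 y hy, T.op_zero]; exact bot_le
    have h2 : ν' (Poss.pt x) ≤ integralMeasure T ν' φ := by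
      rw [integralMeasure_apply]
      refine le_iSup_of_le x ?_
      rw [hφ1 x (Poss.pt_le.1 le_rfl), T.op_one]
    rw [← h] at h2
    exact absurd (h2.trans h1) (not_le.2 ((hO' B hBO).trans ha'))
  refine fun ν ν' h => Poss.ext fun F => ?_
  rw [Poss.eq_iSup, Poss.eq_iSup]
  exact iSup_congr fun x => le_antisymm (key ν' ν h.symm x) (key ν ν' h x)

end integral

/-! ### The capacity induced by a `∗`-measure -/

namespace StarMeasure

variable {T : ContinuousTNorm} {X : Type u} [TopologicalSpace X]

theorem mono (m : StarMeasure T X) {φ ψ : C(X, I)} (h : ∀ x, φ x ≤ ψ x) : m φ ≤ m ψ := by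
  have : φ ⊔ ψ = ψ := ContinuousMap.ext fun x => sup_eq_right.2 (h x)
  rw [← this, m.2.map_sup]
  exact le_sup_left

theorem map_zero (m : StarMeasure T X) : m (ContinuousMap.const X 0) = 0 := by
  have : ContinuousMap.const X 0 = T.scale 0 (ContinuousMap.const X (1 : I)) :=
    ContinuousMap.ext fun _ => (T.zero_op 1).symm
  rw [this, m.2.map_scale, T.zero_op]

/-- The value at a closed set of the capacity induced by a `∗`-measure: the infimum of the values
on the functions equal to `1` on the set. -/
noncomputable def outerVal (m : StarMeasure T X) (F : Closeds X) : I :=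
  sInf {r | ∃ φ : C(X, I), (∀ x ∈ F, φ x = 1) ∧ m φ = r}

theorem outerVal_le (m : StarMeasure T X) {F : Closeds X} {φ : C(X, I)} (h : ∀ x ∈ F, φ x = 1) :
    m.outerVal F ≤ m φ := sInf_le ⟨φ, h, rfl⟩

theorem outerVal_lt_iff {m : StarMeasure T X} {F : Closeds X} {a : I} :
    m.outerVal F < a ↔ ∃ φ : C(X, I), (∀ x ∈ F, φ x = 1) ∧ m φ < a := by
  refine ⟨fun h => ?_, fun ⟨φ, h, hlt⟩ => (m.outerVal_le h).trans_lt hlt⟩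
  obtain ⟨_, ⟨φ, hφ, rfl⟩, hlt⟩ := sInf_lt_iff.1 h
  exact ⟨φ, hφ, hlt⟩

theorem outerVal_mono (m : StarMeasure T X) {F G : Closeds X} (h : F ≤ G) :
    m.outerVal F ≤ m.outerVal G :=
  le_sInf (by rintro _ ⟨φ, hφ, rfl⟩; exact m.outerVal_le fun x hx => hφ x (h hx))

variable [NormalSpace X]

/-- The test function in the definition of `outerVal` can be chosen equal to `1` on a
neighbourhood. -/
theorem exists_eq_one_on_open {m : StarMeasure T X} {F : Closeds X} {a : I}
    (h : m.outerVal F < a) :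
    ∃ (O : Opens X) (ψ : C(X, I)), (F : Set X) ⊆ O ∧ (∀ x ∈ O, ψ x = 1) ∧ m ψ < a := by
  obtain ⟨φ, hφ, hlt⟩ := outerVal_lt_iff.1 h
  -- Writing `a = 1 ∗ a` leaves room to shrink both factors: `m φ < c ∗ s` with `c < 1` and `s < a`.
  rw [← T.one_op a] at hlt
  obtain ⟨c, s, hcs, hc, hs⟩ := T.exists_lt hlt
  obtain ⟨c', hcc', hc'⟩ := exists_between hc
  -- With `ψ = 1` on `{φ ≥ c'}` and `ψ = 0` off `{φ > c}`, homogeneity and `c ∗ ψ ≤ φ` give `c ∗ m ψ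
  -- ≤ m φ < c ∗ s`, which forces `m ψ < a`. As `c' < 1`, the set `{φ > c'}` is a neighbourhood of
  -- `F`.
  obtain ⟨ψ, hψ1, hψ0⟩ := exists_eq_one_eq_zero (F := upperSet φ c') (O := openSuperlevel φ c)
    fun x hx => hcc'.trans_le (mem_upperSet.1 hx)
  refine ⟨openSuperlevel φ c', ψ, fun x hx => ?_, fun x hx => hψ1 x (mem_upperSet.2 ?_), ?_⟩
  · change c' < φ x
    rwa [hφ x hx]
  · exact le_of_lt (show c' < φ x from hx)
  · have hle : T.op c (m ψ) ≤ m φ := by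
      rw [← m.2.map_scale]
      refine m.mono fun x => ?_
      change T.op c (ψ x) ≤ φ x
      by_cases hx : c < φ x
      · exact (T.op_le_left _ _).trans hx.le
      · rw [hψ0 x hx, T.op_zero]; exact bot_le
    by_contra! hge
    exact absurd (hcs.trans_le (T.op_le_op le_rfl (hs.le.trans hge))) (not_lt.2 hle)

/-- The capacity induced by a `∗`-measure. -/
noncomputable def capacity (m : StarMeasure T X) : Capacity X where
  toFun := m.outerVal
  map_univ := by
    refine le_antisymm le_top (le_sInf ?_)
    rintro _ ⟨φ, hφ, rfl⟩
    rw [show φ = ContinuousMap.const X 1 from ContinuousMap.ext fun x => hφ x trivial,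
      m.2.map_one]
  -- On the empty set the test condition is vacuous, so the zero function is admissible.
  map_empty := le_antisymm ((m.outerVal_le (F := ⊥) (φ := ContinuousMap.const X 0)
    fun _ hx => (show False from hx).elim).trans m.map_zero.le) bot_le
  mono _ _ h := m.outerVal_mono h
  usc F a h := by
    obtain ⟨O, ψ, hO, hψ, hlt⟩ := exists_eq_one_on_open h
    exact ⟨O, hO, fun B hB => (m.outerVal_le fun x hx => hψ x (hB hx)).trans_lt hlt⟩

end StarMeasure

/-! ### Recovering a `∗`-measure from its capacity -/

section surjective

variable {X : Type u} [TopologicalSpace X] [CompactSpace X] [T2Space X] {T : ContinuousTNorm}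

/-- The possibility capacity induced by a `∗`-measure. -/
noncomputable def StarMeasure.poss (m : StarMeasure T X) : Poss X :=
  ⟨m.capacity, Poss.isPossibility_of_sup _ fun F G => by
    refine le_of_forall_gt fun a ha => ?_
    obtain ⟨φ, hφ, hφa⟩ := outerVal_lt_iff.1 (lt_of_le_of_lt le_sup_left ha)
    obtain ⟨ψ, hψ, hψa⟩ := outerVal_lt_iff.1 (lt_of_le_of_lt le_sup_right ha)
    refine outerVal_lt_iff.2 ⟨φ ⊔ ψ, fun x hx => ?_, ?_⟩
    · rw [ContinuousMap.sup_apply]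
      refine le_antisymm le_top ?_
      rcases hx with hx | hx
      · exact (hφ x hx).ge.trans le_sup_left
      · exact (hψ x hx).ge.trans le_sup_right
    · rw [m.2.map_sup]; exact max_lt hφa hψa⟩

/-- For `s < t`, a Urysohn function `ψ` equal to 1 on `{φ ≥ t}` and to 0 off `{φ > s}` satisfies `s
∗ ψ ≤ φ`, so the value at `{φ ≥ t}` combined with `s` is at most `m φ`. Continuity of `∗` passes
from `s` to `t`. -/
theorem StarMeasure.op_outerVal_upperSet_le (m : StarMeasure T X) (φ : C(X, I)) (t : I) :
    T.op (m.outerVal (upperSet φ t)) t ≤ m φ := by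
  by_contra! hlt
  obtain ⟨r, s, hrs, hr, hs⟩ := T.exists_lt hlt
  obtain ⟨ψ, hψ1, hψ0⟩ := exists_eq_one_eq_zero (F := upperSet φ t) (O := openSuperlevel φ s)
    fun x hx => hs.trans_le (mem_upperSet.1 hx)
  have h1 : T.op s (m ψ) ≤ m φ := by
    rw [← m.2.map_scale]
    refine m.mono fun x => ?_
    change T.op s (ψ x) ≤ φ x
    by_cases hx : s < φ x
    · exact (T.op_le_left _ _).trans hx.le
    · rw [hψ0 x hx, T.op_zero]; exact bot_le
  have h2 : T.op r s ≤ T.op s (m ψ) := by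
    rw [T.op_comm]
    exact T.op_le_op le_rfl (hr.le.trans (m.outerVal_le hψ1))
  exact absurd (h2.trans h1) (not_le.2 hrs)

/-- A `∗`-measure is bounded by any strict upper bound of `ν({x}) ∗ φ(x)`, `x ∈ X`, where `ν` is
the induced capacity. -/
theorem StarMeasure.le_of_forall_pt_lt (m : StarMeasure T X) (φ : C(X, I)) {a : I} (h0 : 0 < a)
    (h : ∀ x, T.op (m.outerVal (Poss.pt x)) (φ x) < a) : m φ ≤ a := by
  -- Local majorants `χ` of `φ` with `m χ < a` are glued by finite maxima, which `m` preserves.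
  -- Positivity of `a` serves the empty set.
  have := isCompact_univ (X := X).induction_on
    (p := fun s => ∃ χ : C(X, I), (∀ x ∈ s, φ x ≤ χ x) ∧ m χ < a)
    ⟨ContinuousMap.const X 0, by simp, by rwa [m.map_zero]⟩
    (by
      rintro s t hst ⟨χ, hχ, hlt⟩
      exact ⟨χ, fun x hx => hχ x (hst hx), hlt⟩)
    (by
      rintro s t ⟨χ, hχ, hlt⟩ ⟨χ', hχ', hlt'⟩
      refine ⟨χ ⊔ χ', fun x hx => ?_, by rw [m.2.map_sup]; exact max_lt hlt hlt'⟩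
      rw [ContinuousMap.sup_apply]
      rcases hx with hx | hx
      exacts [(hχ x hx).trans le_sup_left, (hχ' x hx).trans le_sup_right])
    (by
      intro x _
      -- Near `x` the majorant is `s ∗ ψ`, where `φ ≤ s` and `ψ = 1` near `x` and `m ψ ≤ r`. A
      -- factor that cannot be enlarged strictly is 1, and its bound is then trivial.
      obtain ⟨r, s, hrs, hr, hs⟩ := T.exists_gt (h x)
      have hφs : ∀ᶠ y in nhds x, φ y ≤ s := by
        rcases hs with hs | rfl
        · exact (φ.continuous.continuousAt.eventually (gt_mem_nhds hs)).mono fun y hy => le_of_lt hy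
        · exact Filter.Eventually.of_forall fun y => le_top
      have hψ : ∃ ψ : C(X, I), (∀ᶠ y in nhds x, ψ y = 1) ∧ m ψ ≤ r := by
        rcases hr with hr | rfl
        · obtain ⟨O, ψ, hO, hψ, hlt⟩ := exists_eq_one_on_open hr
          exact ⟨ψ, Filter.mem_of_superset (O.isOpen.mem_nhds (hO (Set.mem_singleton x))) hψ, hlt.le⟩
        · exact ⟨ContinuousMap.const X 1, Filter.Eventually.of_forall fun _ => rfl, le_top⟩
      obtain ⟨ψ, hψ, hle⟩ := hψ
      refine ⟨_, mem_nhdsWithin_of_mem_nhds (hφs.and hψ), T.scale s ψ, ?_, ?_⟩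
      · rintro y ⟨hy, hy'⟩
        change φ y ≤ T.op s (ψ y)
        rwa [hy', T.op_one]
      · rw [m.2.map_scale, T.op_comm]
        exact (T.op_le_op hle le_rfl).trans_lt hrs)
  obtain ⟨χ, hχ, hlt⟩ := this
  exact (m.mono fun x => hχ x trivial).trans hlt.le

theorem integralMeasure_poss (m : StarMeasure T X) : integralMeasure T m.poss = m := by
  refine StarMeasure.ext fun φ => le_antisymm (iSup_le (m.op_outerVal_upperSet_le φ)) ?_
  refine le_of_forall_gt fun a ha => ?_
  -- The covering lemma needs a positive strict bound at every point; any `b` above the integral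
  -- provides one.
  obtain ⟨b, hb, hba⟩ := exists_between ha
  rw [integralMeasure_apply] at hb
  exact (m.le_of_forall_pt_lt φ (lt_of_le_of_lt bot_le hb) fun x =>
    (le_iSup (fun x => T.op (m.poss (Poss.pt x)) (φ x)) x).trans_lt hb).trans_lt hba

theorem integralMeasure_bijective (T : ContinuousTNorm) :
    Function.Bijective (integralMeasure T : Poss X → StarMeasure T X) :=
  ⟨integralMeasure_injective T, fun m => ⟨m.poss, integralMeasure_poss m⟩⟩

end surjective

/-- The natural isomorphism `l : Π → A^∗`. -/
noncomputable def integralNatIso (T : ContinuousTNorm) :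
    possFunctor.{u} ≅ starFunctor.{u} T :=
  NatIso.ofComponents
    -- Continuity of the inverse is automatic for a continuous bijection of compacta.
    (fun X => CompHausLike.isoOfBijective
      (CompHausLike.ofHom _ ⟨integralMeasure T, integralMeasure_continuous T⟩ :
        CompHaus.of (Poss X) ⟶ CompHaus.of (StarMeasure T X)) (integralMeasure_bijective T))
    fun f => by ext ν; exact integralMeasure_map T f.hom.hom ν

/-- The isomorphism of monads `l : 𝕌_∗ → 𝔸^∗`. -/
noncomputable def integralMonadIso (T : ContinuousTNorm) :
    possMonad.{u} T ≅ starMonad.{u} T :=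
  MonadIso.mk (integralNatIso T)
    (fun X => by ext x; exact integralMeasure_unit T x)
    (fun X => by ext D; exact integralMeasure_mul T D)

end PossibilityMonad

theorem mainTheorem4 (T : PossibilityMonad.ContinuousTNorm) :
    ∃ l : PossibilityMonad.possMonad.{u} T ≅ PossibilityMonad.starMonad.{u} T,
      ∀ (X : CompHaus.{u}) (ν : PossibilityMonad.Poss X) (φ : C(X, PossibilityMonad.I)),
        PossibilityMonad.StarMeasure.proj φ (l.hom.app X ν) =
          PossibilityMonad.tNormedIntegral T ν.1 φ :=
  -- The components are `integralMeasure T` by construction, so the integral formula holds by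
  -- unfolding.
  ⟨PossibilityMonad.integralMonadIso T, fun _ _ _ => rfl⟩
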